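/- **Theorem (Representation, Abramov).** Let $(X,\Sigma,\mu)$ be a probability space and let $\varphi:X\to X$ be measurable and measure-preserving. On the Abelian group $L^0(X;\mathbb T)$ of (classes modulo null sets of) measurable functions $f$ with $|f|=1$ a.e., let $\Lambda f:=(f\circ\varphi)\cdot\overline f$, let $G:=\bigcup_{n\ge 0}\ker(\Lambda^n)$ be the group of unimodular quasi-eigenvectors and $\Lambda(G)\subseteq G$ the group of quasi-eigenvalues. Suppose that the system is totally ergodic (every power $\varphi^m$, $m\ge 1$, is ergodic) and has quasi-discrete spectrum (the linear hull of $G$ is dense in $L^2(X)$). A *signature* is a triple $(H,\Lambda,\iota)$ consisting of an Abelian group $H$, an endomorphism $\Lambda$ of $H$ with $H=\bigcup_{n\ge 0}\ker(\Lambda^n)$, and an injective homomorphism $\iota:H_1:=\ker\Lambda\to\mathbb T$. An *isomorphism* of signatures $(H,\Lambda,\iota)\to(H',\Lambda',\iota')$ is a group isomorphism $\alpha:H\to H'$ with $\Lambda'\circ\alpha=\alpha\circ\Lambda$ and $\iota'\circ\alpha=\iota$ on $\ker\Lambda$. The signature of the above system is $(\Lambda(G),\Lambda|_{\Lambda(G)},\iota)$,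 where $\iota(c\mathbf 1)=c$ (by ergodicity, the elements of $\ker\Lambda$ are constant). Let $(H,\Lambda,\iota)$ be a signature equal, or more generally isomorphic, to the signature of the system. Let $H^*$ be the compact dual group of the discrete group $H$, with its normalized Haar measure $\mathrm m$ on the Borel sets, let $\Phi$ be the automorphism $\Phi(h)=h\,\Lambda h$ of $H$, and let $\Phi^*$ be the dual automorphism $\Phi^*(\chi)=\chi\circ\Phi$ of $H^*$. Then $\iota$ extends to a homomorphism $\eta:H\to\mathbb T$, and for **every** such extension $\eta\in H^*$ the system $(X,\mu;\varphi)$ is Markov isomorphic to the affine automorphism system $(H^*,\mathrm m;\Phi^*,\eta)$, that is, to $H^*$ with the $\mathrm m$-preserving map $\psi(\chi)=\Phi^*(\chi)\cdot\eta$. In other words, there is a surjective bounded linear operator $S:L^1(X,\mu)\to L^1(H^*,\mathrm m)$ (complex $L^1$-spaces) which preserves the constant function $\mathbf 1$, positivity and integrals, satisfies $|Sf|=S|f|$ for all $f$, and intertwines the Koopman operators: $S(f\circ\varphi)=(Sf)\circ\psi$. -/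

import Mathlib

open MeasureTheory

noncomputable section

namespace QuasiDiscrete

universe u v w

/-! ### Signatures -/

section Signatures

/-- A signature `(H, Λ, ι)`: an Abelian group `H`, a quasi-nilpotent endomorphism `Λ` of `H`, i.e.
`H = ⋃ₙ ker (Λ ^ n)`, and a monomorphism `ι` from `H₁ = ker Λ` to the circle group. -/
structure Signature (H : Type u) [CommGroup H] where
  Λ : H →* H
  quasiNilpotent : ∀ h : H, ∃ n : ℕ, (Λ^[n]) h = 1
  ι : Λ.ker →* Circle
  ι_injective : Function.Injective ι

/-- `S` and `S'` are isomorphic: some group isomorphism `α` satisfies `Λ' ∘ α = α ∘ Λ`, and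
`ι' ∘ α = ι` on `ker Λ`. -/
def Signature.IsIsomorphic {H : Type u} [CommGroup H] {H' : Type v} [CommGroup H']
    (S : Signature H) (S' : Signature H') : Prop :=
  ∃ α : H ≃* H', (∀ h, S'.Λ (α h) = α (S.Λ h)) ∧
    ∀ (h : S.Λ.ker) (h' : S'.Λ.ker), (h' : H') = α h → S'.ι h' = S.ι h

/-- The endomorphism `Φ h = h * Λ h`. -/
def Signature.ΦHom {H : Type u} [CommGroup H] (S : Signature H) : H →* H where
  toFun h := h * S.Λ h
  map_one' := by simp
  map_mul' a b := by simp [mul_mul_mul_comm]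

theorem Signature.bijective_ΦHom {H : Type u} [CommGroup H] (S : Signature H) :
    Function.Bijective S.ΦHom := by
  have key : ∀ (n : ℕ) (h : H), (S.Λ^[n]) h = 1 →
      (S.ΦHom h = 1 → h = 1) ∧ ∃ g, S.ΦHom g = h := by
    intro n
    induction n with
    | zero =>
      intro h hh
      have h1 : h = 1 := by simpa using hh
      exact ⟨fun _ => h1, 1, by simp [h1]⟩
    | succ n ih =>
      intro h hh
      have hΛ : (S.Λ^[n]) (S.Λ h) = 1 := by simpa [Function.iterate_succ_apply] using hh
      obtain ⟨hinj, g, hg⟩ := ih _ hΛ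
      refine ⟨fun he => ?_, h * g⁻¹, ?_⟩
      · have e1 : h * S.Λ h = 1 := he
        have e2 : S.ΦHom (S.Λ h) = 1 := by
          change S.Λ h * S.Λ (S.Λ h) = 1
          rw [← map_mul, e1, map_one]
        rw [hinj e2, mul_one] at e1
        exact e1
      · rw [map_mul, map_inv, hg]
        change h * S.Λ h * (S.Λ h)⁻¹ = h
        simp
  refine ⟨(injective_iff_map_eq_one _).2 fun h hh => ?_, fun h => ?_⟩
  · obtain ⟨n, hn⟩ := S.quasiNilpotent h
    exact (key n h hn).1 hh
  · obtain ⟨n, hn⟩ := S.quasiNilpotent h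
    exact (key n h hn).2

/-- The automorphism `Φ h = h * Λ h` of `H`. -/
def Signature.Φ {H : Type u} [CommGroup H] (S : Signature H) : H ≃* H :=
  MulEquiv.ofBijective S.ΦHom S.bijective_ΦHom

theorem Signature.Φ_apply {H : Type u} [CommGroup H] (S : Signature H) (h : H) :
    S.Φ h = h * S.Λ h := rfl

end Signatures

/-! ### Affine automorphism systems -/

section Affine

/-- The dual of a discrete group carries its Borel σ-algebra. -/
instance instMeasurableSpaceDual (A : Type u) [Monoid A] [TopologicalSpace A] :
    MeasurableSpace (PontryaginDual A) := borel _

instance instBorelSpaceDual (A : Type u) [Monoid A] [TopologicalSpace A] :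
    BorelSpace (PontryaginDual A) := ⟨rfl⟩

/-- The affine automorphism `γ ↦ Ψ γ * η`. -/
def affineMap {Γ : Type u} [CommGroup Γ] [TopologicalSpace Γ] (Ψ : Γ ≃ₜ* Γ) (η : Γ) (γ : Γ) : Γ :=
  Ψ γ * η

/-- The Haar probability measure of a compact group. -/
def haarProb (Γ : Type u) [Group Γ] [TopologicalSpace Γ] [IsTopologicalGroup Γ] [CompactSpace Γ]
    [MeasurableSpace Γ] [BorelSpace Γ] : Measure Γ :=
  Measure.haarMeasure (⊤ : TopologicalSpace.PositiveCompacts Γ)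

instance instIsProbabilityMeasureHaarProb (Γ : Type u) [Group Γ] [TopologicalSpace Γ]
    [IsTopologicalGroup Γ] [CompactSpace Γ] [MeasurableSpace Γ] [BorelSpace Γ] :
    IsProbabilityMeasure (haarProb Γ) :=
  ⟨Measure.haarMeasure_self (K₀ := (⊤ : TopologicalSpace.PositiveCompacts Γ))⟩

instance instIsHaarMeasureHaarProb (Γ : Type u) [Group Γ] [TopologicalSpace Γ]
    [IsTopologicalGroup Γ] [CompactSpace Γ] [MeasurableSpace Γ] [BorelSpace Γ] :
    (haarProb Γ).IsHaarMeasure :=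
  Measure.isHaarMeasure_haarMeasure _

/-- Affine automorphisms of a compact Abelian group preserve its Haar probability measure. -/
theorem measurePreserving_affineMap {Γ : Type u} [CommGroup Γ] [TopologicalSpace Γ]
    [IsTopologicalGroup Γ] [CompactSpace Γ] [MeasurableSpace Γ] [BorelSpace Γ]
    (Ψ : Γ ≃ₜ* Γ) (η : Γ) :
    MeasurePreserving (affineMap Ψ η) (haarProb Γ) (haarProb Γ) := by
  have hΨ : MeasurePreserving Ψ (haarProb Γ) (haarProb Γ) := by
    have hm : Measurable Ψ := Ψ.continuous.measurable
    refine ⟨hm, ?_⟩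
    have : (Measure.map Ψ (haarProb Γ)).IsHaarMeasure :=
      Measure.isHaarMeasure_map_of_isFiniteMeasure (haarProb Γ) Ψ.toMulEquiv.toMonoidHom
        Ψ.continuous Ψ.surjective
    have : IsProbabilityMeasure (Measure.map Ψ (haarProb Γ)) :=
      Measure.isProbabilityMeasure_map hm.aemeasurable
    exact Measure.isHaarMeasure_eq_of_isProbabilityMeasure _ _
  exact (measurePreserving_mul_right (haarProb Γ) η).comp hΨ

/-- The dual automorphism `χ ↦ χ ∘ Φ` of the dual group. -/
def dualAut {H : Type u} [CommGroup H] [TopologicalSpace H] [DiscreteTopology H] (Φ : H ≃* H) :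
    PontryaginDual H ≃ₜ* PontryaginDual H where
  toFun := PontryaginDual.map ⟨Φ.toMonoidHom, continuous_of_discreteTopology⟩
  invFun := PontryaginDual.map ⟨Φ.symm.toMonoidHom, continuous_of_discreteTopology⟩
  left_inv χ := by
    ext h
    exact congrArg (fun x => ((χ x : Circle) : ℂ)) (Φ.apply_symm_apply h)
  right_inv χ := by
    ext h
    exact congrArg (fun x => ((χ x : Circle) : ℂ)) (Φ.symm_apply_apply h)
  map_mul' := map_mul _
  continuous_toFun := ContinuousMonoidHom.continuous_toFun _
  continuous_invFun := ContinuousMonoidHom.continuous_toFun _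

theorem dualAut_apply {H : Type u} [CommGroup H] [TopologicalSpace H] [DiscreteTopology H]
    (Φ : H ≃* H) (χ : PontryaginDual H) (h : H) : dualAut Φ χ h = χ (Φ h) := rfl

end Affine

/-! ### Isomorphism of measure-preserving systems -/

section Markov

variable {X : Type u} [MeasurableSpace X] {μ : Measure X} {Y : Type v} [MeasurableSpace Y]
  {ν : Measure Y}

/-- The Koopman operator `f ↦ f ∘ φ` on `L¹(X)`. -/
def koopman {φ : X → X} (hφ : MeasurePreserving φ μ μ) : Lp ℂ 1 μ →L[ℂ] Lp ℂ 1 μ :=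
  (Lp.compMeasurePreservingₗᵢ ℂ φ hφ).toContinuousLinearMap

/-- The modulus `|f|` of `f ∈ L¹(X)`. -/
def modulus (f : Lp ℂ 1 μ) : Lp ℂ 1 μ :=
  MemLp.toLp (fun x => ((‖f x‖ : ℝ) : ℂ)) (Lp.memLp f).norm.ofReal

/-- A Markov operator: one-preserving, order-preserving and integral-preserving. -/
structure IsMarkov [IsFiniteMeasure μ] [IsFiniteMeasure ν] (S : Lp ℂ 1 μ →L[ℂ] Lp ℂ 1 ν) :
    Prop where
  map_one : S (Lp.const 1 μ (1 : ℂ)) = Lp.const 1 ν (1 : ℂ)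
  nonneg : ∀ f : Lp ℂ 1 μ, (∀ᵐ x ∂μ, 0 ≤ (f x).re ∧ (f x).im = 0) →
    ∀ᵐ y ∂ν, 0 ≤ (S f y).re ∧ (S f y).im = 0
  integral_eq : ∀ f : Lp ℂ 1 μ, ∫ y, S f y ∂ν = ∫ x, f x ∂μ

/-- A Markov isomorphism: a surjective Markov operator that is a lattice homomorphism. -/
structure IsMarkovIso [IsFiniteMeasure μ] [IsFiniteMeasure ν] (S : Lp ℂ 1 μ →L[ℂ] Lp ℂ 1 ν) :
    Prop extends IsMarkov S where
  map_modulus : ∀ f : Lp ℂ 1 μ, S (modulus f) = modulus (S f)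
  surjective : Function.Surjective S

/-- The systems `(X, μ; φ)` and `(Y, ν; ψ)` are (Markov) isomorphic: there is an intertwining
Markov isomorphism between their `L¹`-spaces. -/
def MarkovIsomorphic [IsFiniteMeasure μ] [IsFiniteMeasure ν] {φ : X → X} {ψ : Y → Y}
    (hφ : MeasurePreserving φ μ μ) (hψ : MeasurePreserving ψ ν ν) : Prop :=
  ∃ S : Lp ℂ 1 μ →L[ℂ] Lp ℂ 1 ν, IsMarkovIso S ∧ ∀ f, S (koopman hφ f) = koopman hψ (S f)

end Markov

/-! ### Quasi-discrete spectrum -/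

section Spectrum

variable {X : Type u} [MeasurableSpace X] {μ : Measure X} {φ : X → X}

/-- Every power `φ ^ m`, `m ≥ 1`, is ergodic. -/
def TotallyErgodic (φ : X → X) (μ : Measure X) : Prop :=
  ∀ m : ℕ, 1 ≤ m → Ergodic (φ^[m]) μ

theorem TotallyErgodic.ergodic (h : TotallyErgodic φ μ) : Ergodic φ μ := by
  simpa using h 1 le_rfl

/-- The derived homomorphism `Λ f = (f ∘ φ) * f⁻¹` (and `f⁻¹` is the complex conjugate of `f`) on
the group `X →ₘ[μ] Circle` of (classes of) measurable functions with values in the circle. -/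
def derived (hφ : MeasurePreserving φ μ μ) : (X →ₘ[μ] Circle) →* (X →ₘ[μ] Circle) where
  toFun f := f.compMeasurePreserving φ hφ * f⁻¹
  map_one' := by
    have : (1 : X →ₘ[μ] Circle).compMeasurePreserving φ hφ = 1 := rfl
    rw [this, inv_one, mul_one]
  map_mul' f g := by
    have : (f * g).compMeasurePreserving φ hφ
        = f.compMeasurePreserving φ hφ * g.compMeasurePreserving φ hφ := by
      induction f using AEEqFun.induction_on
      induction g using AEEqFun.induction_on
      rfl
    rw [this, mul_inv, mul_mul_mul_comm]

/-- The group `G = ⋃ₙ ker (Λ ^ n)` of unimodular quasi-eigenvectors. -/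
def quasiEigenvectors (hφ : MeasurePreserving φ μ μ) : Subgroup (X →ₘ[μ] Circle) where
  carrier := {f | ∃ n : ℕ, ((derived hφ)^[n]) f = 1}
  one_mem' := ⟨0, rfl⟩
  mul_mem' := by
    rintro f g ⟨m, hm⟩ ⟨n, hn⟩
    refine ⟨m + n, ?_⟩
    rw [iterate_map_mul, Function.iterate_add_apply _ m n g, hn, add_comm m n,
      Function.iterate_add_apply, hm]
    simp
  inv_mem' := by
    rintro f ⟨n, hn⟩
    exact ⟨n, by rw [iterate_map_inv, hn, inv_one]⟩

/-- The group `H = Λ(G)` of quasi-eigenvalues. -/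
def quasiEigenvalues (hφ : MeasurePreserving φ μ μ) : Subgroup (X →ₘ[μ] Circle) :=
  (quasiEigenvectors hφ).map (derived hφ)

theorem quasiEigenvalues_le (hφ : MeasurePreserving φ μ μ) :
    quasiEigenvalues hφ ≤ quasiEigenvectors hφ := by
  rintro _ ⟨f, ⟨n, hn⟩, rfl⟩
  refine ⟨n, ?_⟩
  rw [← Function.iterate_succ_apply, Function.iterate_succ_apply', hn, map_one]

/-- The restriction of `Λ` to the group of quasi-eigenvalues. -/
def derivedRestrict (hφ : MeasurePreserving φ μ μ) :
    quasiEigenvalues hφ →* quasiEigenvalues hφ :=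
  ((derived hφ).comp (quasiEigenvalues hφ).subtype).codRestrict _
    fun h => ⟨h, quasiEigenvalues_le hφ h.2, rfl⟩

theorem coe_derivedRestrict_iterate (hφ : MeasurePreserving φ μ μ) (n : ℕ)
    (h : quasiEigenvalues hφ) :
    (((derivedRestrict hφ)^[n] h : quasiEigenvalues hφ) : X →ₘ[μ] Circle)
      = ((derived hφ)^[n]) (h : X →ₘ[μ] Circle) := by
  induction n with
  | zero => rfl
  | succ n ih =>
    rw [Function.iterate_succ_apply', Function.iterate_succ_apply', ← ih]
    rfl

/-- For an ergodic system, the elements of `ker Λ` are the unimodular constants. -/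
theorem exists_eq_const (hφ : Ergodic φ μ)
    (h : (derivedRestrict hφ.toMeasurePreserving).ker) :
    ∃ c : Circle, ((h : quasiEigenvalues hφ.toMeasurePreserving) : X →ₘ[μ] Circle)
      = AEEqFun.const X c := by
  apply hφ.eq_const_of_compMeasurePreserving_eq
  exact mul_inv_eq_one.1 (congrArg Subtype.val h.2)

theorem const_injective [NeZero μ] {c d : Circle}
    (h : (AEEqFun.const X c : X →ₘ[μ] Circle) = AEEqFun.const X d) : c = d := by
  have h1 := (AEEqFun.coeFn_const (μ := μ) X c).symm.trans
    ((Filter.EventuallyEq.of_eq (congrArg _ h)).trans (AEEqFun.coeFn_const (μ := μ) X d))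
  obtain ⟨x, hx⟩ := h1.exists
  exact hx

/-- The signature `(H, Λ, ι)` of an ergodic system: `H` is the group of quasi-eigenvalues, `Λ` the
restriction of the derived homomorphism, and `ι` maps a constant function to its value. -/
def systemSignature [IsProbabilityMeasure μ] (hφ : Ergodic φ μ) :
    Signature (quasiEigenvalues hφ.toMeasurePreserving) where
  Λ := derivedRestrict hφ.toMeasurePreserving
  quasiNilpotent h := by
    obtain ⟨n, hn⟩ := quasiEigenvalues_le _ h.2
    exact ⟨n, Subtype.ext ((coe_derivedRestrict_iterate _ n h).trans hn)⟩
  ι :=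
    { toFun := fun h => (exists_eq_const hφ h).choose
      map_one' := const_injective (X := X) (μ := μ) (exists_eq_const hφ 1).choose_spec.symm
      map_mul' := fun a b => const_injective (X := X) (μ := μ) <| by
        rw [← (exists_eq_const hφ (a * b)).choose_spec]
        calc _ = ((a : quasiEigenvalues hφ.toMeasurePreserving) : X →ₘ[μ] Circle)
              * ((b : quasiEigenvalues hφ.toMeasurePreserving) : X →ₘ[μ] Circle) := rfl
          _ = AEEqFun.const X (exists_eq_const hφ a).choose
              * AEEqFun.const X (exists_eq_const hφ b).choose := by
            rw [← (exists_eq_const hφ a).choose_spec, ← (exists_eq_const hφ b).choose_spec]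
          _ = _ := rfl }
  ι_injective a b hab := by
    apply Subtype.ext
    apply Subtype.ext
    have hab' : (exists_eq_const hφ a).choose = (exists_eq_const hφ b).choose := hab
    rw [(exists_eq_const hφ a).choose_spec, (exists_eq_const hφ b).choose_spec, hab']

/-- The defining property of `ι`: an element of `ker Λ` is the constant function `ι h`. -/
theorem eq_const_systemSignature_ι [IsProbabilityMeasure μ] (hφ : Ergodic φ μ)
    (h : (systemSignature hφ).Λ.ker) :
    ((h : quasiEigenvalues hφ.toMeasurePreserving) : X →ₘ[μ] Circle)
      = AEEqFun.const X ((systemSignature hφ).ι h) :=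
  (exists_eq_const hφ h).choose_spec

/-- A circle-valued function as an element of the complex space `L²(X)`. -/
def toL2 [IsFiniteMeasure μ] (f : X →ₘ[μ] Circle) : Lp ℂ 2 μ :=
  MemLp.toLp (fun x => (f x : ℂ)) <|
    MemLp.of_bound ((continuous_subtype_val : Continuous ((↑) : Circle → ℂ)).comp_aestronglyMeasurable f.aestronglyMeasurable) 1
      (Filter.Eventually.of_forall fun x => (Circle.norm_coe (f x)).le)

/-- The linear hull of the unimodular quasi-eigenvectors is dense in `L²(X)`. -/
def HasQuasiDiscreteSpectrum [IsFiniteMeasure μ] (hφ : MeasurePreserving φ μ μ) : Prop :=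
  (Submodule.span ℂ (toL2 '' (quasiEigenvectors hφ : Set (X →ₘ[μ] Circle)))).topologicalClosure = ⊤

end Spectrum

end QuasiDiscrete

end

/-!
The group `H` of quasi-eigenvalues indexes an orthonormal basis of `L²(X)` consisting of unimodular
functions, and the affine system on `H*` has the characters `χ ↦ χ h` as its own such basis. The
isomorphism matches the two bases.

Since the circle is divisible, every homomorphism into it extends from subgroups
(`exists_comp_eq_of_ker_le`). This gives the extensions `η` of `ι`, and for every `η` a homomorphism
`σ` from `H` to the quasi-eigenvectors such that `Λ (σ h) = h` and `σ h ∘ φ = η h • σ (Φ h)`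
(`exists_section`); the character `χ ↦ χ h` transforms under `χ ↦ Φ* χ * η` in exactly the same way
(`dualCharacter_comp_affineMap`). Both families integrate to zero for `h ≠ 1`, by total ergodicity
(`integral_eq_zero_of_mem_quasiEigenvectors`) and by translation invariance of Haar measure
(`integral_dualCharacter_eq_zero`). Their linear hulls are dense in `L¹`, by quasi-discrete spectrum
and by Stone–Weierstrass.

Sending `∑ aₕ σ(h)` to `∑ aₕ e(h)`, where `e(h)` is the character `χ ↦ χ h` of `H*`, preserves
products, conjugates and integrals. As `|f|` is a uniform limit of polynomials in `f f̄`, it also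
preserves `L¹`-norms and moduli, and so it extends to a Markov isomorphism of the `L¹`-spaces
(`exists_isMarkovIso`).
-/

open MeasureTheory

noncomputable section

namespace QuasiDiscrete

/-! ### Homomorphisms into the circle -/

instance instDivisibleByAdditiveCircle : DivisibleBy (Additive Circle) ℤ :=
  divisibleByOfSMulRightSurj _ _ fun {n} hn a => by
    obtain ⟨t, ht⟩ := Circle.exp_surjective a.toMul
    refine ⟨Circle.expHom (t / n), ?_⟩
    dsimp only
    rw [← map_zsmul, zsmul_eq_mul, mul_div_cancel₀ _ (Int.cast_ne_zero.2 hn)]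
    exact ht

/-- The circle is an injective Abelian group: a homomorphism into it that is trivial on the kernel
of `f` factors through `f`, even if `f` is not surjective. -/
theorem exists_comp_eq_of_ker_le {A : Type*} {B : Type*} [CommGroup A] [CommGroup B] (f : A →* B)
    (t : A →* Circle) (h : f.ker ≤ t.ker) : ∃ r : B →* Circle, ∀ a, r (f a) = t a := by
  obtain ⟨r, hr⟩ := (Module.Baer.of_divisible (Additive Circle)).extension_property_addMonoidHom
    (MonoidHom.toAdditive (QuotientGroup.kerLift f))
    (QuotientGroup.kerLift_injective f)
    (MonoidHom.toAdditive (QuotientGroup.lift f.ker t h))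
  exact ⟨AddMonoidHom.toMultiplicative r, fun a =>
    DFunLike.congr_fun hr (Additive.ofMul (a : A ⧸ f.ker))⟩

theorem Signature.exists_extension {H : Type*} [CommGroup H] (S : Signature H) :
    ∃ η : H →* Circle, ∀ h : S.Λ.ker, η h = S.ι h :=
  exists_comp_eq_of_ker_le S.Λ.ker.subtype S.ι fun a ha => by
    rw [show a = 1 from Subtype.ext ha]
    exact one_mem _

/-- Characters separate the points of `H`: an extension of the injective `ι` is not `1` at
the last nontrivial iterate `Λ ^ n h`, which lies in `ker Λ`. -/
theorem Signature.exists_character_ne_one {H : Type*} [CommGroup H] (S : Signature H) {h : H}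
    (hh : h ≠ 1) : ∃ χ : H →* Circle, χ h ≠ 1 := by
  classical
  obtain ⟨η, hη⟩ := S.exists_extension
  have hex := S.quasiNilpotent h
  obtain ⟨n, hn⟩ : ∃ n, Nat.find hex = n + 1 :=
    Nat.exists_eq_succ_of_ne_zero fun h0 => hh (by simpa [h0] using Nat.find_spec hex)
  have hker : S.Λ (S.Λ^[n] h) = 1 := by
    simpa [hn, Function.iterate_succ_apply'] using Nat.find_spec hex
  have hne : S.Λ^[n] h ≠ 1 := Nat.find_min hex (by omega)
  refine ⟨⟨⟨fun x => η (S.Λ^[n] x), by simp⟩, by simp⟩, fun h1 => hne ?_⟩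
  have h2 : η (S.Λ^[n] h) = 1 := h1
  have h3 := hη ⟨_, hker⟩
  rw [h2] at h3
  exact congrArg Subtype.val (S.ι_injective (a₂ := 1) (by rw [← h3, map_one]))

section
open scoped InnerProductSpace
variable {X : Type*} [MeasurableSpace X] {μ : Measure X} {φ : X → X}

/-! ### Orthogonality of quasi-eigenvectors -/

theorem compMeasurePreserving_eq_derived_mul (hφ : MeasurePreserving φ μ μ) (f : X →ₘ[μ] Circle) :
    f.compMeasurePreserving φ hφ = derived hφ f * f := by
  simp [derived]

theorem compMeasurePreserving_mul (hφ : MeasurePreserving φ μ μ) (f g : X →ₘ[μ] Circle) :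
    (f * g).compMeasurePreserving φ hφ
      = f.compMeasurePreserving φ hφ * g.compMeasurePreserving φ hφ := by
  induction f using AEEqFun.induction_on
  induction g using AEEqFun.induction_on
  rfl

theorem derived_const (hφ : MeasurePreserving φ μ μ) (c : Circle) :
    derived hφ (AEEqFun.const X c : X →ₘ[μ] Circle) = 1 := mul_inv_cancel (AEEqFun.const X c)

theorem exists_eq_const_of_derived_eq_one (hφ : Ergodic φ μ) {f : X →ₘ[μ] Circle}
    (h : derived hφ.toMeasurePreserving f = 1) : ∃ c : Circle, f = AEEqFun.const X c :=
  hφ.eq_const_of_compMeasurePreserving_eq (mul_inv_eq_one.1 h)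

/-- The embedding of the circle as the group of unimodular constants. -/
def constHom (μ : Measure X) : Circle →* (X →ₘ[μ] Circle) where
  toFun := AEEqFun.const X
  map_one' := rfl
  map_mul' _ _ := rfl

theorem integral_coe_compMeasurePreserving (hφ : MeasurePreserving φ μ μ) (f : X →ₘ[μ] Circle) :
    ∫ x, (f.compMeasurePreserving φ hφ x : ℂ) ∂μ = ∫ x, (f x : ℂ) ∂μ := by
  rw [integral_congr_ae (g := fun x => (f (φ x) : ℂ))]
  · rw [← integral_map (f := fun x => (f x : ℂ)) hφ.aemeasurable, hφ.map_eq]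
    rw [hφ.map_eq]
    exact (continuous_subtype_val : Continuous ((↑) : Circle → ℂ)).comp_aestronglyMeasurable
      f.aestronglyMeasurable
  · filter_upwards [AEEqFun.coeFn_compMeasurePreserving f hφ] with x hx
    rw [hx]; rfl

theorem integral_coe_const_mul (c : Circle) (f : X →ₘ[μ] Circle) :
    ∫ x, ((AEEqFun.const X c * f : X →ₘ[μ] Circle) x : ℂ) ∂μ = c * ∫ x, (f x : ℂ) ∂μ := by
  rw [← integral_const_mul]
  apply integral_congr_ae
  filter_upwards [AEEqFun.coeFn_mul (AEEqFun.const X c) f, AEEqFun.coeFn_const (μ := μ) X c]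
    with x hx hc
  rw [hx, Pi.mul_apply, hc]; rfl

theorem inner_toL2 [IsFiniteMeasure μ] (f g : X →ₘ[μ] Circle) :
    ⟪toL2 f, toL2 g⟫_ℂ = ∫ x, ((f⁻¹ * g : X →ₘ[μ] Circle) x : ℂ) ∂μ := by
  rw [L2.inner_def]
  apply integral_congr_ae
  filter_upwards [MemLp.coeFn_toLp (μ := μ) (p := 2) (f := fun x => (f x : ℂ)) _,
    MemLp.coeFn_toLp (μ := μ) (p := 2) (f := fun x => (g x : ℂ)) _,
    AEEqFun.coeFn_mul f⁻¹ g, AEEqFun.coeFn_inv f] with x h1 h2 h3 h4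
  unfold toL2
  rw [h1, h2, h3, Pi.mul_apply, h4, Pi.inv_apply, Circle.coe_mul, Circle.coe_inv_eq_conj,
    RCLike.inner_apply, mul_comm]

/-- By Bessel's inequality, infinitely many pairwise orthogonal unimodular functions cannot have the
same nonzero integral. -/
theorem integral_eq_zero_of_orthogonal [IsProbabilityMeasure μ] (f : ℕ → X →ₘ[μ] Circle) (c : ℂ)
    (hc : ∀ n, ∫ x, (f n x : ℂ) ∂μ = c)
    (hf : ∀ m n, m < n → ∫ x, (((f m)⁻¹ * f n : X →ₘ[μ] Circle) x : ℂ) ∂μ = 0) : c = 0 := by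
  have hone : ∀ g : X →ₘ[μ] Circle, ∫ x, ((g⁻¹ * g : X →ₘ[μ] Circle) x : ℂ) ∂μ = 1 := fun g => by
    rw [inv_mul_cancel, integral_congr_ae (g := fun _ => (1 : ℂ))]
    · simp
    · filter_upwards [AEEqFun.coeFn_one (μ := μ) (α := X) (β := Circle)] with x hx
      simp [hx]
  have hnorm : ∀ g : X →ₘ[μ] Circle, ‖toL2 g‖ = 1 := fun g => by
    have : ((‖toL2 g‖ : ℝ) : ℂ) ^ 2 = 1 := by
      have h := inner_self_eq_norm_sq_to_K (𝕜 := ℂ) (toL2 g)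
      rw [inner_toL2, hone] at h
      exact h.symm
    have h2 : ‖toL2 g‖ ^ 2 = 1 := by exact_mod_cast this
    nlinarith [norm_nonneg (toL2 g)]
  have hon : Orthonormal ℂ fun n => toL2 (f n) := by
    refine ⟨fun n => hnorm _, fun m n hmn => ?_⟩
    rcases lt_or_gt_of_ne hmn with h | h
    · exact (inner_toL2 _ _).trans (hf m n h)
    · rw [inner_eq_zero_symm]
      exact (inner_toL2 _ _).trans (hf n m h)
  have hin : ∀ n, ‖⟪toL2 (f n), toL2 (1 : X →ₘ[μ] Circle)⟫_ℂ‖ = ‖c‖ := fun n => by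
    rw [norm_inner_symm, inner_toL2, inv_one, one_mul, hc]
  have hb : ∀ N : ℕ, N * ‖c‖ ^ 2 ≤ 1 := fun N => by
    have h := hon.sum_inner_products_le (x := toL2 (1 : X →ₘ[μ] Circle)) (s := Finset.range N)
    simpa [hin, hnorm] using h
  by_contra hc0
  obtain ⟨N, hN⟩ := exists_nat_gt (1 / ‖c‖ ^ 2)
  have hpos : 0 < ‖c‖ ^ 2 := by positivity
  rw [div_lt_iff₀ hpos] at hN
  exact absurd (hb N) (not_le.2 hN)

/-- In a totally ergodic system a nonconstant quasi-eigenvector `f` has integral zero. By induction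
on the order of `f`: the quotients `(f ∘ φ ^ k) / f` have smaller order. If none of them with
`k ≥ 1` is constant, then the functions `f ∘ φ ^ m` are orthogonal and Bessel's inequality applies;
if one of them is, then `f` is an eigenfunction of the ergodic map `φ ^ k`. -/
theorem integral_eq_zero_of_mem_quasiEigenvectors [IsProbabilityMeasure μ] (hφ : TotallyErgodic φ μ)
    {f : X →ₘ[μ] Circle} (hf : f ∈ quasiEigenvectors hφ.ergodic.toMeasurePreserving)
    (hne : derived hφ.ergodic.toMeasurePreserving f ≠ 1) : ∫ x, (f x : ℂ) ∂μ = 0 := by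
  obtain ⟨n, hn⟩ := hf
  set Λ := derived hφ.ergodic.toMeasurePreserving with hΛ
  induction n generalizing f with
  | zero =>
    have h1 : f = 1 := hn
    exact absurd (by rw [h1, map_one]) hne
  | succ n ih =>
    -- `u m = f ∘ φ ^ m`
    let u : ℕ → X →ₘ[μ] Circle :=
      fun m => f.compMeasurePreserving φ^[m] (hφ.ergodic.toMeasurePreserving.iterate m)
    have hu0 : u 0 = f := AEEqFun.compMeasurePreserving_id f
    have hcomp : ∀ m k (g : X →ₘ[μ] Circle),
        g.compMeasurePreserving φ^[m + k] (hφ.ergodic.toMeasurePreserving.iterate (m + k))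
          = (g.compMeasurePreserving φ^[k] (hφ.ergodic.toMeasurePreserving.iterate k)
            ).compMeasurePreserving φ^[m] (hφ.ergodic.toMeasurePreserving.iterate m) := by
      intro m k g
      induction g using AEEqFun.induction_on
      simp only [AEEqFun.compMeasurePreserving_mk, add_comm m k, Function.iterate_add]
      rfl
    have hus : ∀ m, u (m + 1) = Λ (u m) * u m := fun m => by
      rw [hΛ, ← compMeasurePreserving_eq_derived_mul]
      exact (congrArg _ (add_comm m 1)).trans (hcomp 1 m f)
    have hadd : ∀ m k, (u m)⁻¹ * u (m + k)
        = ((u 0)⁻¹ * u k).compMeasurePreserving φ^[m]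
          (hφ.ergodic.toMeasurePreserving.iterate m) := by
      intro m k
      rw [compMeasurePreserving_mul, ← hcomp, hu0, eq_comm, mul_left_inj]
      induction f using AEEqFun.induction_on
      rfl
    have hΛu : ∀ k, Λ^[n] ((u 0)⁻¹ * u k) = 1 := by
      have hk : ∀ k, Λ^[n + 1] (u k) = 1 := fun k => by
        induction k with
        | zero => rw [hu0]; exact hn
        | succ k ihk =>
          rw [hus, iterate_map_mul, ihk, mul_one, ← Function.iterate_succ_apply,
            Function.iterate_succ_apply', ihk, map_one]
      intro k
      induction k with
      | zero => simp
      | succ k ihk =>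
        rw [hus, mul_left_comm, iterate_map_mul, ihk, mul_one, ← Function.iterate_succ_apply, hk]
    have hint : ∀ m, ∫ x, (u m x : ℂ) ∂μ = ∫ x, (f x : ℂ) ∂μ := fun m =>
      integral_coe_compMeasurePreserving _ _
    by_cases hk : ∃ k, 1 ≤ k ∧ Λ ((u 0)⁻¹ * u k) = 1
    · obtain ⟨k, hk1, hk⟩ := hk
      obtain ⟨c, hc⟩ := exists_eq_const_of_derived_eq_one hφ.ergodic hk
      have hc' : u k = AEEqFun.const X c * f := by rw [← hc, hu0, mul_comm, mul_inv_cancel_left]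
      have hI := hint k
      rw [hc', integral_coe_const_mul] at hI
      rcases eq_or_ne c 1 with rfl | hc1
      · obtain ⟨d, hd⟩ := (hφ k hk1).eq_const_of_compMeasurePreserving_eq
          (g := f) (hc'.trans (one_mul f))
        exact absurd (by rw [hd]; exact derived_const _ _) hne
      · have : ((c : ℂ) - 1) * ∫ x, (f x : ℂ) ∂μ = 0 := by rw [sub_mul, hI, one_mul, sub_self]
        refine (mul_eq_zero.1 this).resolve_left fun h => hc1 ?_
        exact Circle.ext (sub_eq_zero.1 h)
    · push Not at hk
      refine integral_eq_zero_of_orthogonal u _ hint fun m l hml => ?_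
      obtain ⟨k, rfl⟩ := Nat.exists_eq_add_of_lt hml
      rw [add_assoc, hadd, integral_coe_compMeasurePreserving]
      exact ih (hk _ (by omega)) (hΛu _)
end

section
variable {X : Type*} [MeasurableSpace X] {μ : Measure X} {φ : X → X}

/-! ### A section of the derived homomorphism -/

/-- For every extension `η` of `ι`, the derived homomorphism has a multiplicative section `σ` over
the group `H` of quasi-eigenvalues, normalized so that `σ h ∘ φ = η h • σ (Φ h)`; every
quasi-eigenvector is a constant multiple of some `σ h`. It is obtained by dividing
quasi-eigenvectors by `r`, where `r` is a homomorphism into the circle that is the identity on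
constants and `η` on quasi-eigenvalues; the two prescriptions agree on `ker Λ` because `η` extends
`ι`. -/
theorem exists_section [IsProbabilityMeasure μ] (hφ : Ergodic φ μ) {H : Type*} [CommGroup H]
    (S : Signature H) (hS : (systemSignature hφ).IsIsomorphic S) (η : H →* Circle)
    (hη : ∀ h : S.Λ.ker, η h = S.ι h) :
    ∃ σ : H →* (X →ₘ[μ] Circle),
      (∀ h, σ h ∈ quasiEigenvectors hφ.toMeasurePreserving) ∧
      (∀ h, derived hφ.toMeasurePreserving (σ h) = 1 → h = 1) ∧
      (∀ g ∈ quasiEigenvectors hφ.toMeasurePreserving, ∃ c h, g = AEEqFun.const X c * σ h) ∧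
      ∀ h, (σ h).compMeasurePreserving φ hφ.toMeasurePreserving
        = AEEqFun.const X (η h) * σ (S.Φ h) := by
  obtain ⟨α, hα, hαι⟩ := hS
  set Λ := derived hφ.toMeasurePreserving with hΛ
  set G := quasiEigenvectors hφ.toMeasurePreserving with hG
  -- `β` identifies `H` with the group of quasi-eigenvalues
  let β : H →* (X →ₘ[μ] Circle) := (Subgroup.subtype _).comp α.symm.toMonoidHom
  have hβΛ : ∀ h, Λ (β h) = β (S.Λ h) := fun h => by
    have h1 := hα (α.symm h)
    rw [α.apply_symm_apply] at h1
    have h2 : α.symm (S.Λ h) = (systemSignature hφ).Λ (α.symm h) := by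
      rw [h1, α.symm_apply_apply]
    exact (congrArg Subtype.val h2).symm
  have hβinj : ∀ h, β h = 1 → h = 1 := fun h hh =>
    α.symm.map_eq_one_iff.1 (Subtype.ext hh)
  have hβG : ∀ h, β h ∈ G := fun h => quasiEigenvalues_le _ (α.symm h).2
  have hβsurj : ∀ g ∈ G, ∃ h, Λ g = β h := fun g hg =>
    ⟨α ⟨Λ g, g, hg, rfl⟩, by simp [β]⟩
  have hβconst : ∀ h, S.Λ h = 1 → β h = AEEqFun.const X (η h) := fun h hh => by
    have hk : (systemSignature hφ).Λ (α.symm h) = 1 :=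
      Subtype.ext ((hβΛ h).trans (by rw [hh, map_one]; rfl))
    have h1 := hαι ⟨α.symm h, hk⟩ ⟨h, hh⟩ (α.apply_symm_apply h).symm
    rw [hη ⟨h, hh⟩, h1]
    exact eq_const_systemSignature_ι hφ ⟨α.symm h, hk⟩
  obtain ⟨r, hr⟩ := exists_comp_eq_of_ker_le ((constHom μ).coprod β)
    ((MonoidHom.id Circle).coprod η) (by
      rintro ⟨c, h⟩ hch
      have h1 : AEEqFun.const X c * β h = 1 := hch
      have h2 : S.Λ h = 1 := hβinj _ <| by
        rw [← hβΛ, eq_inv_of_mul_eq_one_right h1, map_inv, derived_const, inv_one]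
      rw [hβconst h h2] at h1
      exact const_injective (X := X) (μ := μ) h1)
  have hrc : ∀ c, r (AEEqFun.const X c) = c := fun c => by
    have h1 : r (AEEqFun.const X c * β 1) = c * η 1 := hr (c, 1)
    simpa using h1
  have hrβ : ∀ h, r (β h) = η h := fun h => by simpa using hr (1, h)
  let π : (X →ₘ[μ] Circle) →* (X →ₘ[μ] Circle) := MonoidHom.id _ * ((constHom μ).comp r)⁻¹
  have hπ : ∀ g, g = AEEqFun.const X (r g) * π g := fun g => by
    change g = AEEqFun.const X (r g) * (g * (AEEqFun.const X (r g))⁻¹)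
    rw [mul_left_comm, mul_inv_cancel, mul_one]
  have hπΛ : ∀ g g', Λ g = Λ g' → π g = π g' := fun g g' h => by
    obtain ⟨c, hc⟩ := exists_eq_const_of_derived_eq_one hφ (f := g * g'⁻¹)
      (by rw [map_mul, map_inv, h, mul_inv_cancel])
    have h1 := hπ (AEEqFun.const X c)
    rw [hrc] at h1
    rw [← mul_inv_eq_one, ← map_inv, ← map_mul, hc]
    exact left_eq_mul.1 h1
  have hΛπ : ∀ g, Λ (π g) = Λ g := fun g => by
    conv_rhs => rw [hπ g, map_mul, derived_const, one_mul]
  have hsec : ∀ h, ∃ g ∈ G, Λ g = β h := fun h => (α.symm h).2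
  choose s hsG hs using hsec
  let σ : H →* (X →ₘ[μ] Circle) := MonoidHom.mk' (fun h => π (s h)) fun a b => by
    rw [← map_mul]
    exact hπΛ _ _ (by rw [hs, map_mul, map_mul, hs, hs])
  have hΛσ : ∀ h, Λ (σ h) = β h := fun h => (hΛπ _).trans (hs h)
  have hπσ : ∀ g h, Λ g = β h → π g = σ h := fun g h hg => hπΛ _ _ (hg.trans (hs h).symm)
  refine ⟨σ, fun h => ?_, fun h hh => hβinj h ((hΛσ h).symm.trans hh), fun g hg => ?_, fun h => ?_⟩
  · obtain ⟨n, hn⟩ := hβG h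
    exact ⟨n + 1, by rw [Function.iterate_succ_apply, ← hΛ, hΛσ, hn]⟩
  · obtain ⟨h, hh⟩ := hβsurj g hg
    exact ⟨r g, h, by rw [← hπσ g h hh]; exact hπ g⟩
  · rw [compMeasurePreserving_eq_derived_mul, ← hΛ, hΛσ, S.Φ_apply, map_mul,
      ← hπσ (β h) (S.Λ h) (hβΛ h)]
    nth_rw 1 [hπ (β h)]
    rw [hrβ, mul_assoc, mul_comm (σ h)]
end

section
variable {X : Type*} [MeasurableSpace X] {μ : Measure X} {Y : Type*} [MeasurableSpace Y]
  {ν : Measure Y} {H : Type*}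

/-! ### Corresponding trigonometric polynomials -/

/-- `Corresponds σ τ f g` says that, up to null sets, `f = ∑ aₕ σ(h)` and `g = ∑ aₕ τ(h)` with the
same finitely many coefficients `aₕ`. -/
inductive Corresponds (σ : H → (X →ₘ[μ] Circle)) (τ : H → (Y →ₘ[ν] Circle)) :
    (X → ℂ) → (Y → ℂ) → Prop
  | of (h : H) : Corresponds σ τ (fun x => (σ h x : ℂ)) (fun y => (τ h y : ℂ))
  | add {f f' g g'} : Corresponds σ τ f g → Corresponds σ τ f' g' →
      Corresponds σ τ (f + f') (g + g')
  | smul (c : ℂ) {f g} : Corresponds σ τ f g → Corresponds σ τ (c • f) (c • g)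
  | congr {f f' g g'} : Corresponds σ τ f g → f =ᵐ[μ] f' → g =ᵐ[ν] g' → Corresponds σ τ f' g'

namespace Corresponds

theorem aestronglyMeasurable_coe (f : X →ₘ[μ] Circle) :
    AEStronglyMeasurable (fun x => (f x : ℂ)) μ :=
  (continuous_subtype_val : Continuous ((↑) : Circle → ℂ)).comp_aestronglyMeasurable
    f.aestronglyMeasurable

section
variable {σ : H → (X →ₘ[μ] Circle)} {τ : H → (Y →ₘ[ν] Circle)} {f f' : X → ℂ} {g g' : Y → ℂ}

protected theorem symm (h : Corresponds σ τ f g) : Corresponds τ σ g f := by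
  induction h with
  | of h => exact .of h
  | add _ _ h1 h2 => exact h1.add h2
  | smul c _ h => exact h.smul c
  | congr _ h1 h2 h => exact h.congr h2 h1

theorem aestronglyMeasurable (h : Corresponds σ τ f g) : AEStronglyMeasurable f μ := by
  induction h with
  | of h => exact aestronglyMeasurable_coe _
  | add _ _ h1 h2 => exact h1.add h2
  | smul c _ h => exact h.const_smul c
  | congr _ h1 _ h => exact h.congr h1

theorem bounded (h : Corresponds σ τ f g) : ∃ C : ℝ, ∀ᵐ x ∂μ, ‖f x‖ ≤ C := by
  induction h with
  | of h => exact ⟨1, .of_forall fun x => (Circle.norm_coe _).le⟩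
  | add _ _ h1 h2 =>
    obtain ⟨C, h1⟩ := h1
    obtain ⟨D, h2⟩ := h2
    exact ⟨C + D, by filter_upwards [h1, h2] with x h1 h2 using norm_add_le_of_le h1 h2⟩
  | smul c _ h =>
    obtain ⟨C, h⟩ := h
    refine ⟨‖c‖ * C, ?_⟩
    filter_upwards [h] with x h
    rw [Pi.smul_apply, norm_smul]
    gcongr
  | congr _ h1 _ h =>
    obtain ⟨C, h⟩ := h
    exact ⟨C, by filter_upwards [h, h1] with x h h1 using h1 ▸ h⟩

theorem memLp [IsFiniteMeasure μ] (h : Corresponds σ τ f g) (p : ENNReal) : MemLp f p μ :=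
  let ⟨C, hC⟩ := h.bounded
  .of_bound h.aestronglyMeasurable C hC

theorem integrable [IsFiniteMeasure μ] (h : Corresponds σ τ f g) : Integrable f μ :=
  memLp_one_iff_integrable.1 (h.memLp 1)

theorem integral_eq [IsFiniteMeasure μ] [IsFiniteMeasure ν]
    (hστ : ∀ h, ∫ x, (σ h x : ℂ) ∂μ = ∫ y, (τ h y : ℂ) ∂ν) (h : Corresponds σ τ f g) :
    ∫ x, f x ∂μ = ∫ y, g y ∂ν := by
  induction h with
  | of h => exact hστ h
  | add c1 c2 h1 h2 =>
    rw [integral_add' c1.integrable c2.integrable, h1, h2,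
      integral_add' c1.symm.integrable c2.symm.integrable]
  | smul c _ h => simp only [Pi.smul_apply, integral_smul, h]
  | congr _ h1 h2 h => rw [← integral_congr_ae h1, h, integral_congr_ae h2]
end

section
variable [CommGroup H] {σ : H →* (X →ₘ[μ] Circle)} {τ : H →* (Y →ₘ[ν] Circle)}
  {f f' : X → ℂ} {g g' : Y → ℂ}

theorem coe_map_mul (a b : H) :
    (fun x => (σ a x : ℂ)) * (fun x => (σ b x : ℂ)) =ᵐ[μ] fun x => (σ (a * b) x : ℂ) := by
  rw [map_mul]
  filter_upwards [AEEqFun.coeFn_mul (σ a) (σ b)] with x hx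
  simp [hx]

theorem coe_map_inv (a : H) :
    (fun x => (σ a⁻¹ x : ℂ)) =ᵐ[μ] star fun x => (σ a x : ℂ) := by
  rw [map_inv]
  filter_upwards [AEEqFun.coeFn_inv (σ a)] with x hx
  rw [hx, Pi.inv_apply, Circle.coe_inv_eq_conj]
  rfl

theorem coe_map_one : (fun x => (σ 1 x : ℂ)) =ᵐ[μ] 1 := by
  rw [map_one]
  filter_upwards [AEEqFun.coeFn_one (μ := μ) (α := X) (β := Circle)] with x hx
  simp [hx]

theorem mul (h : Corresponds σ τ f g) (h' : Corresponds σ τ f' g') :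
    Corresponds σ τ (f * f') (g * g') := by
  induction h with
  | of a =>
    induction h' with
    | of b => exact (of (a * b)).congr (coe_map_mul a b).symm (coe_map_mul a b).symm
    | add _ _ h1 h2 => rw [mul_add, mul_add]; exact h1.add h2
    | smul c _ h => rw [mul_smul_comm, mul_smul_comm]; exact h.smul c
    | congr _ h1 h2 h => exact h.congr (.mul .rfl h1) (.mul .rfl h2)
  | add _ _ h1 h2 => rw [add_mul, add_mul]; exact h1.add h2
  | smul c _ h => rw [smul_mul_assoc, smul_mul_assoc]; exact h.smul c
  | congr _ h1 h2 h => exact h.congr (.mul h1 .rfl) (.mul h2 .rfl)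

theorem star (h : Corresponds σ τ f g) : Corresponds σ τ (star f) (star g) := by
  induction h with
  | of a => exact (of a⁻¹).congr (coe_map_inv a) (coe_map_inv a)
  | add _ _ h1 h2 => rw [star_add, star_add]; exact h1.add h2
  | smul c _ h => rw [star_smul, star_smul]; exact h.smul _
  | congr _ h1 h2 h => exact h.congr h1.star h2.star

theorem one : Corresponds σ τ 1 1 := (of 1).congr coe_map_one coe_map_one

theorem pow (h : Corresponds σ τ f g) (n : ℕ) : Corresponds σ τ (f ^ n) (g ^ n) := by
  induction n with
  | zero => rw [pow_zero, pow_zero]; exact one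
  | succ n ih => rw [pow_succ, pow_succ]; exact ih.mul h

theorem eval (h : Corresponds σ τ f g) (p : Polynomial ℂ) :
    Corresponds σ τ (fun x => p.eval (f x)) (fun y => p.eval (g y)) := by
  induction p using Polynomial.induction_on' with
  | add p q hp hq => simp only [Polynomial.eval_add]; exact hp.add hq
  | monomial n c => simp only [Polynomial.eval_monomial]; exact (h.pow n).smul c

/-- By Weierstrass, `|f| = √(f f̄)` is a uniform limit of polynomials in `f f̄`, and the same
polynomials serve for `g`. -/
theorem exists_near_norm (h : Corresponds σ τ f g) {ε : ℝ} (hε : 0 < ε) :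
    ∃ f' g', Corresponds σ τ f' g' ∧ (∀ᵐ x ∂μ, ‖f' x - (‖f x‖ : ℂ)‖ ≤ ε) ∧
      ∀ᵐ y ∂ν, ‖g' y - (‖g y‖ : ℂ)‖ ≤ ε := by
  obtain ⟨C, hC⟩ := h.bounded
  obtain ⟨D, hD⟩ := h.symm.bounded
  obtain ⟨p, hp⟩ := exists_polynomial_near_of_continuousOn 0 (max C D ^ 2) Real.sqrt
    Real.continuous_sqrt.continuousOn ε hε
  have key : ∀ z : ℂ, ‖z‖ ≤ max C D →
      ‖(p.map Complex.ofRealHom).eval (z * Star.star z) - (‖z‖ : ℂ)‖ ≤ ε := fun z hz => by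
    have h1 : z * Star.star z = ((‖z‖ ^ 2 : ℝ) : ℂ) := by
      rw [Complex.ofReal_pow]; exact RCLike.mul_conj z
    have h2 : (p.map Complex.ofRealHom).eval ((‖z‖ ^ 2 : ℝ) : ℂ) = (p.eval (‖z‖ ^ 2) : ℝ) :=
      Polynomial.eval_map_apply Complex.ofRealHom (‖z‖ ^ 2)
    rw [h1, h2, ← Complex.ofReal_sub, Complex.norm_real]
    have h3 := hp (‖z‖ ^ 2) ⟨by positivity, by gcongr⟩
    rw [Real.sqrt_sq (norm_nonneg z)] at h3
    exact h3.le
  refine ⟨_, _, (h.mul h.star).eval (p.map Complex.ofRealHom), ?_, ?_⟩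
  · filter_upwards [hC] with x hx using key _ (hx.trans (le_max_left _ _))
  · filter_upwards [hD] with x hx using key _ (hx.trans (le_max_right _ _))

/-- Corresponding functions have the same `L¹`-norm, since `|f|` and `|g|` are uniformly
approximated by corresponding functions. -/
theorem integral_norm_eq [IsProbabilityMeasure μ] [IsProbabilityMeasure ν]
    (hστ : ∀ h, ∫ x, (σ h x : ℂ) ∂μ = ∫ y, (τ h y : ℂ) ∂ν) (h : Corresponds σ τ f g) :
    ∫ x, ‖f x‖ ∂μ = ∫ y, ‖g y‖ ∂ν := by
  have key : ∀ ε : ℝ, 0 < ε → ‖((∫ x, ‖f x‖ ∂μ : ℝ) : ℂ) - (∫ y, ‖g y‖ ∂ν : ℝ)‖ ≤ ε + ε := by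
    intro ε hε
    obtain ⟨f', g', h', hf, hg⟩ := h.exists_near_norm hε
    have e1 : ‖∫ x, (f' x - (‖f x‖ : ℂ)) ∂μ‖ ≤ ε := by
      simpa using norm_integral_le_of_norm_le_const hf
    have e2 : ‖∫ y, (g' y - (‖g y‖ : ℂ)) ∂ν‖ ≤ ε := by
      simpa using norm_integral_le_of_norm_le_const hg
    have i1 : Integrable (fun x => (‖f x‖ : ℂ)) μ := h.integrable.norm.ofReal
    have i2 : Integrable (fun y => (‖g y‖ : ℂ)) ν := h.symm.integrable.norm.ofReal
    rw [integral_sub h'.integrable i1, integral_complex_ofReal] at e1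
    rw [integral_sub h'.symm.integrable i2, integral_complex_ofReal,
      ← h'.integral_eq hστ] at e2
    have := norm_sub_le_norm_sub_add_norm_sub ((∫ x, ‖f x‖ ∂μ : ℝ) : ℂ)
      (∫ x, f' x ∂μ) (∫ y, ‖g y‖ ∂ν : ℝ)
    rw [norm_sub_rev] at e1
    exact this.trans (add_le_add e1 e2)
  have h0 : ‖((∫ x, ‖f x‖ ∂μ : ℝ) : ℂ) - (∫ y, ‖g y‖ ∂ν : ℝ)‖ ≤ 0 :=
    le_of_forall_pos_le_add fun ε hε => by simpa using key (ε / 2) (by positivity)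
  exact Complex.ofReal_injective (sub_eq_zero.1 (norm_le_zero_iff.1 h0))

end
end Corresponds
end

section
variable {X : Type*} [MeasurableSpace X] {μ : Measure X} {Y : Type*} [MeasurableSpace Y]
  {ν : Measure Y} {H : Type*}

/-! ### The Markov isomorphism of two systems of characters -/

theorem coeFn_modulus (f : Lp ℂ 1 μ) : modulus f =ᵐ[μ] fun x => (‖f x‖ : ℂ) :=
  MemLp.coeFn_toLp _

theorem continuous_modulus : Continuous (modulus : Lp ℂ 1 μ → Lp ℂ 1 μ) := by
  have hL : LipschitzWith 1 fun z : ℂ => (‖z‖ : ℂ) :=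
    Complex.isometry_ofReal.lipschitz.comp lipschitzWith_one_norm |>.weaken (by simp)
  have h0 : (‖(0 : ℂ)‖ : ℂ) = 0 := by simp
  have heq : (modulus : Lp ℂ 1 μ → Lp ℂ 1 μ) = hL.compLp h0 :=
    funext fun f => Lp.ext ((coeFn_modulus f).trans (hL.coeFn_compLp h0 f).symm)
  rw [heq]
  exact hL.continuous_compLp h0

/-- A circle-valued function as an element of the complex space `L¹(X)`. -/
def toL1 [IsFiniteMeasure μ] (f : X →ₘ[μ] Circle) : Lp ℂ 1 μ :=
  MemLp.toLp (fun x => (f x : ℂ)) <|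
    .of_bound (Corresponds.aestronglyMeasurable_coe f) 1
      (.of_forall fun x => (Circle.norm_coe (f x)).le)

theorem coeFn_toL1 [IsFiniteMeasure μ] (f : X →ₘ[μ] Circle) : toL1 f =ᵐ[μ] fun x => (f x : ℂ) :=
  MemLp.coeFn_toLp _

theorem toL1_one [IsFiniteMeasure μ] : toL1 (1 : X →ₘ[μ] Circle) = Lp.const 1 μ (1 : ℂ) := by
  apply Lp.ext
  filter_upwards [coeFn_toL1 (1 : X →ₘ[μ] Circle), Lp.coeFn_const 1 μ (1 : ℂ),
    AEEqFun.coeFn_one (μ := μ) (α := X) (β := Circle)] with x h1 h2 h3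
  rw [h1, h2, h3]; rfl

theorem norm_sub_le_of_ae_le [IsProbabilityMeasure μ] {f g : Lp ℂ 1 μ} {ε : ℝ} (hε : 0 ≤ ε)
    (h : ∀ᵐ x ∂μ, ‖f x - g x‖ ≤ ε) : ‖f - g‖ ≤ ε := by
  have := Lp.norm_le_of_ae_bound (f := f - g) (C := ε) hε (by
    filter_upwards [h, Lp.coeFn_sub f g] with x h h1
    rw [h1]; exact h)
  have h1 : (measureUnivNNReal μ : ℝ) = 1 := by
    rw [measureUnivNNReal, measure_univ]; rfl
  simpa [h1] using this

/-- The trigonometric polynomial `∑ aₕ σ(h)` as an element of `L¹(X)`. -/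
def trig [IsFiniteMeasure μ] (σ : H → (X →ₘ[μ] Circle)) : (H →₀ ℂ) →ₗ[ℂ] Lp ℂ 1 μ :=
  Finsupp.linearCombination ℂ fun h => toL1 (σ h)

section
variable [IsFiniteMeasure μ] [IsFiniteMeasure ν] {σ : H → (X →ₘ[μ] Circle)}
  {τ : H → (Y →ₘ[ν] Circle)}

theorem trig_single (h : H) : trig σ (Finsupp.single h 1) = toL1 (σ h) := by
  simp [trig]

theorem corresponds_trig [Nonempty H] (a : H →₀ ℂ) : Corresponds σ τ (trig σ a) (trig τ a) := by
  induction a using Finsupp.induction_linear with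
  | zero =>
    obtain ⟨h⟩ := ‹Nonempty H›
    refine ((Corresponds.of h).smul 0).congr ?_ ?_
    · rw [map_zero]; filter_upwards [Lp.coeFn_zero ℂ 1 μ] with x hx; rw [hx]; simp
    · rw [map_zero]; filter_upwards [Lp.coeFn_zero ℂ 1 ν] with x hx; rw [hx]; simp
  | add a b ha hb =>
    rw [map_add, map_add]
    exact (ha.add hb).congr (Lp.coeFn_add _ _).symm (Lp.coeFn_add _ _).symm
  | single h c =>
    have e : Finsupp.single h c = c • Finsupp.single h (1 : ℂ) := by simp
    rw [e, map_smul, map_smul, trig_single, trig_single]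
    exact ((Corresponds.of h).smul c).congr
      ((Filter.EventuallyEq.const_smul (coeFn_toL1 (σ h)) c).symm.trans (Lp.coeFn_smul _ _).symm)
      ((Filter.EventuallyEq.const_smul (coeFn_toL1 (τ h)) c).symm.trans (Lp.coeFn_smul _ _).symm)

theorem Corresponds.exists_trig {f : X → ℂ} {g : Y → ℂ} (h : Corresponds σ τ f g) :
    ∃ a : H →₀ ℂ, trig σ a =ᵐ[μ] f ∧ trig τ a =ᵐ[ν] g := by
  induction h with
  | of h => exact ⟨.single h 1, by rw [trig_single]; exact coeFn_toL1 _,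
      by rw [trig_single]; exact coeFn_toL1 _⟩
  | add _ _ h1 h2 =>
    obtain ⟨a, h1, h1'⟩ := h1
    obtain ⟨b, h2, h2'⟩ := h2
    refine ⟨a + b, ?_, ?_⟩
    · rw [map_add]; exact (Lp.coeFn_add _ _).trans (h1.add h2)
    · rw [map_add]; exact (Lp.coeFn_add _ _).trans (h1'.add h2')
  | smul c _ h =>
    obtain ⟨a, h1, h2⟩ := h
    refine ⟨c • a, ?_, ?_⟩
    · rw [map_smul]; exact (Lp.coeFn_smul _ _).trans (h1.const_smul c)
    · rw [map_smul]; exact (Lp.coeFn_smul _ _).trans (h2.const_smul c)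
  | congr _ h1 h2 h =>
    obtain ⟨a, h3, h4⟩ := h
    exact ⟨a, h3.trans h1, h4.trans h2⟩
end

theorem nonneg_iff_modulus_eq (f : Lp ℂ 1 μ) :
    (∀ᵐ x ∂μ, 0 ≤ (f x).re ∧ (f x).im = 0) ↔ modulus f = f := by
  have key : ∀ z : ℂ, (0 ≤ z.re ∧ z.im = 0) ↔ (‖z‖ : ℂ) = z := fun z => by
    refine ⟨fun h => ?_, fun h => ?_⟩
    · have h1 : z = (z.re : ℂ) := Complex.ext rfl h.2
      rw [h1, Complex.norm_real, Real.norm_of_nonneg h.1]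
    · rw [← h]
      exact ⟨norm_nonneg z, rfl⟩
  constructor
  · intro h
    apply Lp.ext
    filter_upwards [coeFn_modulus f, h] with x h1 h2
    rw [h1, (key _).1 h2]
  · intro h
    have h1 := coeFn_modulus f
    rw [h] at h1
    filter_upwards [h1] with x h1 using (key _).2 h1.symm

/-- Two families of circle-valued functions indexed by the same group, with equal integrals and
dense linear hulls, are carried to each other by a Markov isomorphism: the `L¹`-isometry that takes
every trigonometric polynomial to its counterpart. -/
theorem exists_isMarkovIso [IsProbabilityMeasure μ] [IsProbabilityMeasure ν] [CommGroup H]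
    (σ : H →* (X →ₘ[μ] Circle)) (τ : H →* (Y →ₘ[ν] Circle))
    (hστ : ∀ h, ∫ x, (σ h x : ℂ) ∂μ = ∫ y, (τ h y : ℂ) ∂ν)
    (hσ : DenseRange (trig σ)) (hτ : DenseRange (trig τ)) :
    ∃ S : Lp ℂ 1 μ →L[ℂ] Lp ℂ 1 ν, IsMarkovIso S ∧ ∀ h, S (toL1 (σ h)) = toL1 (τ h) := by
  have hnorm : ∀ a, ‖trig τ a‖ = ‖trig σ a‖ := fun a => by
    rw [L1.norm_eq_integral_norm, L1.norm_eq_integral_norm,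
      (corresponds_trig a).integral_norm_eq hστ]
  let S : Lp ℂ 1 μ →L[ℂ] Lp ℂ 1 ν := (trig τ).extendOfNorm (trig σ)
  have hS : ∀ a, S (trig σ a) = trig τ a :=
    LinearMap.extendOfNorm_eq hσ ⟨1, fun a => by rw [hnorm, one_mul]⟩
  have hSnorm : ∀ f, ‖S f‖ = ‖f‖ := fun f =>
    hσ.induction_on (p := fun f => ‖S f‖ = ‖f‖) f (isClosed_eq (by fun_prop) (by fun_prop))
      fun a => by
      rw [hS, hnorm]
  have hsingle : ∀ h, S (toL1 (σ h)) = toL1 (τ h) := fun h => by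
    rw [← trig_single, hS, trig_single]
  have hmod : ∀ f, S (modulus f) = modulus (S f) := fun f => by
    refine hσ.induction_on (p := fun f => S (modulus f) = modulus (S f)) f
      (isClosed_eq (S.continuous.comp continuous_modulus) (continuous_modulus.comp S.continuous))
      fun a => ?_
    rw [hS]
    refine eq_of_forall_dist_le fun ε hε => ?_
    obtain ⟨f', g', h', hf, hg⟩ := (corresponds_trig (σ := σ) (τ := τ) a).exists_near_norm
      (half_pos hε)
    obtain ⟨b, hb, hb'⟩ := h'.exists_trig
    have e1 : ‖modulus (trig σ a) - trig σ b‖ ≤ ε / 2 := norm_sub_le_of_ae_le (half_pos hε).le <| by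
      filter_upwards [hf, hb, coeFn_modulus (trig σ a)] with x h1 h2 h3
      rwa [h2, h3, norm_sub_rev]
    have e2 : ‖trig τ b - modulus (trig τ a)‖ ≤ ε / 2 := norm_sub_le_of_ae_le (half_pos hε).le <| by
      filter_upwards [hg, hb', coeFn_modulus (trig τ a)] with x h1 h2 h3
      rwa [h2, h3]
    rw [← hSnorm, map_sub, hS] at e1
    rw [dist_eq_norm, ← add_halves ε]
    exact (norm_sub_le_norm_sub_add_norm_sub _ (trig τ b) _).trans (add_le_add e1 e2)
  refine ⟨S, ⟨⟨?_, fun f hf => ?_, fun f => ?_⟩, hmod, ?_⟩, hsingle⟩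
  · have h1 := hsingle 1
    rwa [map_one, map_one, toL1_one, toL1_one] at h1
  · rw [nonneg_iff_modulus_eq] at hf ⊢
    rw [← hmod, hf]
  · refine hσ.induction_on (p := fun f => ∫ y, S f y ∂ν = ∫ x, f x ∂μ) f
      (isClosed_eq (continuous_integral.comp S.continuous) continuous_integral) fun a => ?_
    rw [hS, (corresponds_trig a).integral_eq hστ]
  · have hiso : Isometry S := AddMonoidHomClass.isometry_of_norm S hSnorm
    have hcl : IsClosed (Set.range S) := hiso.isClosedEmbedding.isClosed_range
    rw [← Set.range_eq_univ, ← hcl.closure_eq]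
    refine (hτ.mono ?_).closure_eq
    rintro _ ⟨a, rfl⟩
    exact ⟨_, hS a⟩

end

/-! ### Density of the trigonometric polynomials -/

section
variable {X : Type*} [MeasurableSpace X] {μ : Measure X} {H : Type*}

/-- On a probability space `L²` is dense in `L¹`, and `‖·‖₁ ≤ ‖·‖₂`. -/
theorem denseRange_trig_of_span_toL2 [IsProbabilityMeasure μ] (σ : H → (X →ₘ[μ] Circle))
    (hσ : (Submodule.span ℂ (Set.range fun h => toL2 (σ h))).topologicalClosure = ⊤) :
    DenseRange (trig σ) := by
  have hex : ∀ g ∈ Submodule.span ℂ (Set.range fun h => toL2 (σ h)),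
      ∃ a, trig σ a =ᵐ[μ] g := fun g hg => by
    induction hg using Submodule.span_induction with
    | mem g hg =>
      obtain ⟨h, rfl⟩ := hg
      refine ⟨.single h 1, ?_⟩
      rw [trig_single]
      exact (coeFn_toL1 _).trans (MemLp.coeFn_toLp _).symm
    | zero =>
      refine ⟨0, ?_⟩
      rw [map_zero]
      exact (Lp.coeFn_zero ℂ 1 μ).trans (Lp.coeFn_zero ℂ 2 μ).symm
    | add f g _ _ hf hg =>
      obtain ⟨a, ha⟩ := hf
      obtain ⟨b, hb⟩ := hg
      refine ⟨a + b, ?_⟩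
      rw [map_add]
      exact (Lp.coeFn_add _ _).trans ((ha.add hb).trans (Lp.coeFn_add _ _).symm)
    | smul c f _ hf =>
      obtain ⟨a, ha⟩ := hf
      refine ⟨c • a, ?_⟩
      rw [map_smul]
      exact (Lp.coeFn_smul _ _).trans ((ha.const_smul c).trans (Lp.coeFn_smul _ _).symm)
  rw [Metric.denseRange_iff]
  intro f ε hε
  obtain ⟨s, hs⟩ := (Lp.simpleFunc.denseRange (E := ℂ) (μ := μ) (p := 1)
    ENNReal.one_ne_top).exists_dist_lt f (half_pos hε)
  have hs2 : MemLp (s : Lp ℂ 1 μ) 2 μ :=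
    ((Lp.simpleFunc.toSimpleFunc s).memLp_of_finite_measure_preimage 2
      fun _ _ => measure_lt_top _ _).ae_eq (Lp.simpleFunc.toSimpleFunc_eq_toFun s)
  have hd : Dense (Submodule.span ℂ (Set.range fun h => toL2 (σ h)) : Set (Lp ℂ 2 μ)) :=
    Submodule.dense_iff_topologicalClosure_eq_top.2 hσ
  obtain ⟨g, hg, hsg⟩ := hd.exists_dist_lt (hs2.toLp _) (half_pos hε)
  obtain ⟨a, ha⟩ := hex g hg
  refine ⟨a, (dist_triangle _ _ _).trans_lt
    ((add_lt_add hs (lt_of_le_of_lt ?_ hsg)).trans_eq (add_halves ε))⟩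
  rw [Lp.dist_def, Lp.dist_def]
  have heq : ⇑(hs2.toLp _) - ⇑g =ᵐ[μ] ⇑(s : Lp ℂ 1 μ) - ⇑(trig σ a) := hs2.coeFn_toLp.sub ha.symm
  refine ENNReal.toReal_mono ((Lp.memLp _).sub (Lp.memLp _)).eLpNorm_ne_top ?_
  rw [eLpNorm_congr_ae heq]
  exact eLpNorm_le_eLpNorm_of_exponent_le (by norm_num)
    ((Lp.aestronglyMeasurable _).sub (Lp.aestronglyMeasurable _))
end

/-! ### Characters of the dual group -/

section
variable {H : Type*} [CommGroup H] [TopologicalSpace H]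

theorem continuous_dual_eval (h : H) : Continuous fun χ : PontryaginDual H => χ h :=
  (ContinuousEvalConst.continuous_eval_const (F := C(H, Circle)) h).comp
    (ContinuousMonoidHom.isInducing_toContinuousMap H Circle).continuous

/-- The character `χ ↦ χ h` of the dual group as a complex-valued continuous function. -/
def dualEval (h : H) : C(PontryaginDual H, ℂ) :=
  ⟨fun χ => (χ h : ℂ), continuous_subtype_val.comp (continuous_dual_eval h)⟩

theorem dualEval_mul (a b : H) : dualEval (a * b) = dualEval a * dualEval b :=
  ContinuousMap.ext fun χ => by simp [dualEval]

theorem dualEval_one : dualEval (1 : H) = 1 := ContinuousMap.ext fun χ => by simp [dualEval]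

theorem dualEval_inv (a : H) : dualEval a⁻¹ = star (dualEval a) :=
  ContinuousMap.ext fun χ => by
    simp only [dualEval, ContinuousMap.coe_mk, ContinuousMap.star_apply, map_inv,
      Circle.coe_inv_eq_conj]
    rfl

/-- The star subalgebra of `C(H*, ℂ)` generated by the characters. -/
def dualSubalgebra (H : Type*) [CommGroup H] [TopologicalSpace H] :
    StarSubalgebra ℂ C(PontryaginDual H, ℂ) where
  toSubalgebra := Algebra.adjoin ℂ (Set.range dualEval)
  star_mem' := by
    change Algebra.adjoin ℂ (Set.range (dualEval (H := H))) ≤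
      star (Algebra.adjoin ℂ (Set.range (dualEval (H := H))))
    refine Algebra.adjoin_le ?_
    rintro _ ⟨h, rfl⟩
    exact Algebra.subset_adjoin ⟨h⁻¹, dualEval_inv h⟩

theorem toSubmodule_dualSubalgebra : Subalgebra.toSubmodule (dualSubalgebra H).toSubalgebra
    = Submodule.span ℂ (Set.range (dualEval (H := H))) := by
  refine Algebra.adjoin_eq_span_of_subset ℂ (Set.Subset.trans (fun x hx => ?_)
    Submodule.subset_span)
  refine Submonoid.closure_induction (fun _ => id) ⟨1, dualEval_one⟩ ?_ hx
  rintro _ _ _ _ ⟨a, rfl⟩ ⟨b, rfl⟩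
  exact ⟨a * b, dualEval_mul a b⟩

variable [DiscreteTopology H]

theorem span_dualEval_topologicalClosure :
    (Submodule.span ℂ (Set.range (dualEval (H := H)))).topologicalClosure = ⊤ := by
  have hsep : (dualSubalgebra H).SeparatesPoints := fun χ χ' hne => by
    obtain ⟨h, hh⟩ := DFunLike.ne_iff.1 hne
    exact ⟨_, ⟨dualEval h, Algebra.subset_adjoin ⟨h, rfl⟩, rfl⟩, fun e => hh (Circle.ext e)⟩
  rw [← toSubmodule_dualSubalgebra]
  exact congrArg (Subalgebra.toSubmodule <| StarSubalgebra.toSubalgebra ·)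
    (ContinuousMap.starSubalgebra_topologicalClosure_eq_top_of_separatesPoints _ hsep)

/-- The homomorphism taking `h` to the class of the character `χ ↦ χ h` of the dual group. -/
def dualCharacter (H : Type*) [CommGroup H] [TopologicalSpace H] [DiscreteTopology H] :
    H →* (PontryaginDual H →ₘ[haarProb (PontryaginDual H)] Circle) where
  toFun h := AEEqFun.mk (fun χ => χ h) (continuous_dual_eval h).aestronglyMeasurable
  map_one' := by
    rw [AEEqFun.one_def]
    congr 1
    ext χ
    simp
  map_mul' a b := by
    rw [AEEqFun.mk_mul_mk]
    congr 1
    ext χ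
    simp

theorem coeFn_dualCharacter (h : H) :
    dualCharacter H h =ᵐ[haarProb (PontryaginDual H)] fun χ => χ h :=
  AEEqFun.coeFn_mk _ _

theorem toL1_dualCharacter (h : H) : toL1 (dualCharacter H h)
    = ContinuousMap.toLp 1 (haarProb (PontryaginDual H)) ℂ (dualEval h) := by
  apply Lp.ext
  filter_upwards [coeFn_toL1 (dualCharacter H h), coeFn_dualCharacter h,
    ContinuousMap.coeFn_toLp (p := 1) (𝕜 := ℂ) (haarProb (PontryaginDual H)) (dualEval h)]
    with χ h1 h2 h3
  rw [h1, h2, h3]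
  rfl

theorem denseRange_trig_dualCharacter : DenseRange (trig (dualCharacter H)) := by
  have : (haarProb (PontryaginDual H)).Regular := Measure.regular_haarMeasure
  have h := (ContinuousMap.toLp_denseRange ℂ (haarProb (PontryaginDual H)) ℂ
    (ENNReal.one_ne_top)).topologicalClosure_map_submodule span_dualEval_topologicalClosure
  rw [Submodule.map_span, ← Set.range_comp] at h
  have h2 := Submodule.dense_iff_topologicalClosure_eq_top.2 h
  have h3 : (ContinuousMap.toLp 1 (haarProb (PontryaginDual H)) ℂ) ∘ dualEval
      = fun h => toL1 (dualCharacter H h) := funext fun h => (toL1_dualCharacter h).symm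
  have h4 : Set.range (trig (dualCharacter H))
      = (Submodule.span ℂ (Set.range fun h => toL1 (dualCharacter H h)) : Set (Lp ℂ 1 _)) :=
    congrArg SetLike.coe (Finsupp.range_linearCombination ℂ)
  rw [DenseRange, h4, ← h3]
  exact h2

/-- Translation by a character `χ` of `H` with `χ h ≠ 1` multiplies the integral by `χ h`. -/
theorem integral_dualCharacter_eq_zero {h : H} (hh : ∃ χ : H →* Circle, χ h ≠ 1) :
    ∫ χ, (dualCharacter H h χ : ℂ) ∂(haarProb (PontryaginDual H)) = 0 := by
  obtain ⟨χ₀, hχ₀⟩ := hh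
  let χ₁ : PontryaginDual H := (⟨χ₀, continuous_of_discreteTopology⟩ : H →ₜ* Circle)
  have h1 : ∫ χ, (dualCharacter H h χ : ℂ) ∂(haarProb (PontryaginDual H))
      = ∫ χ, (χ h : ℂ) ∂(haarProb (PontryaginDual H)) :=
    integral_congr_ae <| by
      filter_upwards [coeFn_dualCharacter h] with χ hχ
      rw [hχ]
  rw [h1]
  have h2 := integral_mul_left_eq_self (μ := haarProb (PontryaginDual H))
    (fun χ : PontryaginDual H => (χ h : ℂ)) χ₁
  have h3 : ∀ χ : PontryaginDual H, (((χ₁ * χ) h : Circle) : ℂ) = χ₀ h * χ h := fun χ => rfl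
  simp only [h3, integral_const_mul] at h2
  have h4 : ((χ₀ h : ℂ) - 1) * ∫ χ, (χ h : ℂ) ∂(haarProb (PontryaginDual H)) = 0 := by
    rw [sub_mul, h2, one_mul, sub_self]
  exact (mul_eq_zero.1 h4).resolve_left fun h => hχ₀ (Circle.ext (sub_eq_zero.1 h))

end

/-! ### The representation theorem -/

section
variable {X : Type*} [MeasurableSpace X] {μ : Measure X} {φ : X → X}

theorem koopman_toL1 [IsFiniteMeasure μ] (hφ : MeasurePreserving φ μ μ) (f : X →ₘ[μ] Circle) :
    koopman hφ (toL1 f) = toL1 (f.compMeasurePreserving φ hφ) := by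
  apply Lp.ext
  refine (Lp.coeFn_compMeasurePreserving (toL1 f) hφ).trans ?_
  filter_upwards [hφ.quasiMeasurePreserving.ae_eq_comp (coeFn_toL1 f),
    coeFn_toL1 (f.compMeasurePreserving φ hφ), AEEqFun.coeFn_compMeasurePreserving f hφ]
    with x h1 h2 h3
  rw [h1, h2, h3]
  rfl

theorem toL1_const_mul [IsFiniteMeasure μ] (c : Circle) (f : X →ₘ[μ] Circle) :
    toL1 (AEEqFun.const X c * f) = (c : ℂ) • toL1 f := by
  apply Lp.ext
  filter_upwards [coeFn_toL1 (AEEqFun.const X c * f), Lp.coeFn_smul (c : ℂ) (toL1 f),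
    coeFn_toL1 f, AEEqFun.coeFn_mul (AEEqFun.const X c) f, AEEqFun.coeFn_const (μ := μ) X c]
    with x h1 h2 h3 h4 h5
  rw [h1, h2, h4, Pi.mul_apply, h5, Pi.smul_apply, h3]
  rfl

theorem toL2_const_mul [IsFiniteMeasure μ] (c : Circle) (f : X →ₘ[μ] Circle) :
    toL2 (AEEqFun.const X c * f) = (c : ℂ) • toL2 f := by
  apply Lp.ext
  filter_upwards [MemLp.coeFn_toLp (μ := μ) (p := 2)
      (f := fun x => ((AEEqFun.const X c * f : X →ₘ[μ] Circle) x : ℂ)) _,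
    Lp.coeFn_smul (c : ℂ) (toL2 f), MemLp.coeFn_toLp (μ := μ) (p := 2) (f := fun x => (f x : ℂ)) _,
    AEEqFun.coeFn_mul (AEEqFun.const X c) f, AEEqFun.coeFn_const (μ := μ) X c]
    with x h1 h2 h3 h4 h5
  rw [h2, Pi.smul_apply]
  unfold toL2
  rw [h1, h4, Pi.mul_apply, h5, h3]
  rfl

theorem dualCharacter_comp_affineMap {H : Type*} [CommGroup H] [TopologicalSpace H]
    [DiscreteTopology H] (Φ : H ≃* H) (η : PontryaginDual H) (h : H) :
    (dualCharacter H h).compMeasurePreserving _ (measurePreserving_affineMap (dualAut Φ) η)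
      = AEEqFun.const _ (η h) * dualCharacter H (Φ h) := by
  change AEEqFun.mk _ _ = AEEqFun.mk _ _ * AEEqFun.mk _ _
  rw [AEEqFun.mk_mul_mk]
  congr 1
  ext χ
  exact congrArg _ (mul_comm (χ (Φ h)) (η h))
end

end QuasiDiscrete

end

open QuasiDiscrete in
theorem theorem4p1 {X : Type*} [MeasurableSpace X] (μ : MeasureTheory.Measure X)
    [MeasureTheory.IsProbabilityMeasure μ] (φ : X → X) (hφ : TotallyErgodic φ μ)
    (hqds : HasQuasiDiscreteSpectrum hφ.ergodic.toMeasurePreserving)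
    {H : Type*} [CommGroup H] [TopologicalSpace H] [DiscreteTopology H] (S : Signature H)
    (hS : (systemSignature hφ.ergodic).IsIsomorphic S) :
    (∃ η : PontryaginDual H, ∀ h : S.Λ.ker, η (h : H) = S.ι h) ∧
    ∀ η : PontryaginDual H, (∀ h : S.Λ.ker, η (h : H) = S.ι h) →
      MarkovIsomorphic hφ.ergodic.toMeasurePreserving
        (measurePreserving_affineMap (dualAut S.Φ) η) := by
  refine ⟨?_, fun η hη => ?_⟩
  · obtain ⟨η, hη⟩ := S.exists_extension
    exact ⟨(⟨η, continuous_of_discreteTopology⟩ : H →ₜ* Circle), hη⟩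
  obtain ⟨σ, hσG, hσinj, hσspan, hσφ⟩ :=
    exists_section hφ.ergodic S hS (MonoidHomClass.toMonoidHom η) hη
  have hint : ∀ h, ∫ x, (σ h x : ℂ) ∂μ
      = ∫ χ, (dualCharacter H h χ : ℂ) ∂(haarProb (PontryaginDual H)) := fun h => by
    rcases eq_or_ne h 1 with rfl | hh
    · rw [MeasureTheory.integral_congr_ae Corresponds.coe_map_one,
        MeasureTheory.integral_congr_ae Corresponds.coe_map_one]
      simp
    · rw [integral_dualCharacter_eq_zero (S.exists_character_ne_one hh)]
      exact integral_eq_zero_of_mem_quasiEigenvectors hφ (hσG h) fun h1 => hh (hσinj h h1)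
  have hspan : (Submodule.span ℂ (Set.range fun h => toL2 (σ h))).topologicalClosure = ⊤ := by
    refine top_le_iff.1 (hqds.ge.trans (Submodule.topologicalClosure_mono ?_))
    refine Submodule.span_le.2 ?_
    rintro _ ⟨g, hg, rfl⟩
    obtain ⟨c, h, rfl⟩ := hσspan g hg
    rw [toL2_const_mul]
    exact Submodule.smul_mem _ _ (Submodule.subset_span ⟨h, rfl⟩)
  have hdense := denseRange_trig_of_span_toL2 σ hspan
  obtain ⟨T, hT, hTσ⟩ := exists_isMarkovIso σ (dualCharacter H) hint hdense
    denseRange_trig_dualCharacter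
  refine ⟨T, hT, fun f => ?_⟩
  let A := T ∘L koopman hφ.ergodic.toMeasurePreserving
  let B := koopman (measurePreserving_affineMap (dualAut S.Φ) η) ∘L T
  have hAB : ∀ a, A (trig σ a) = B (trig σ a) := fun a => by
    suffices h : A.toLinearMap ∘ₗ trig σ = B.toLinearMap ∘ₗ trig σ from DFunLike.congr_fun h a
    refine Finsupp.lhom_ext' fun h => LinearMap.ext_ring ?_
    change T (koopman _ (trig σ (Finsupp.single h 1))) = koopman _ (T (trig σ (Finsupp.single h 1)))
    rw [trig_single, koopman_toL1, hσφ, toL1_const_mul, map_smul, hTσ, hTσ, koopman_toL1,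
      dualCharacter_comp_affineMap, toL1_const_mul]
    rfl
  exact hdense.induction_on (p := fun f => A f = B f) f
    (isClosed_eq A.continuous B.continuous) hAB
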